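/- For a non-negative integer $n$ let $$A_n=\sum_{k=0}^n\binom{n}{k}^2\binom{n+k}{k}^2\quad\text{and}\quad A'_n=\sum_{k=0}^n\binom{n}{k}^2\binom{n+k}{k}$$ be the Apéry numbers, and let $B_n$ be the Bernoulli numbers, defined by $\frac{x}{e^x-1}=\sum_{n=0}^{\infty}B_n\frac{x^n}{n!}$. For a prime $p$ and rational numbers $a,b$, write $a\equiv b\pmod{p^4}$ if $a-b=p^4c$ for a rational number $c$ whose reduced denominator is not divisible by $p$. Then for every prime $p\ge 5$, $$A_{p-1}\equiv 1+\frac{2}{3}p^3B_{p-3}\pmod{p^4}\quad\text{and}\quad A'_{p-1}\equiv 1+\frac{5}{3}p^3B_{p-3}\pmod{p^4}.$$ -/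

import Mathlib

/-- The Apéry numbers `A_n = ∑_{k=0}^n C(n,k)^2 C(n+k,k)^2` (related to `ζ(3)`). -/
def aperyA (n : ℕ) : ℕ :=
  ∑ k ∈ Finset.range (n + 1), n.choose k ^ 2 * (n + k).choose k ^ 2

/-- The Apéry numbers `A'_n = ∑_{k=0}^n C(n,k)^2 C(n+k,k)` (related to `ζ(2)`). -/
def aperyA' (n : ℕ) : ℕ :=
  ∑ k ∈ Finset.range (n + 1), n.choose k ^ 2 * (n + k).choose k

/-- Congruence of rational numbers modulo `m`: the difference `a - b` is `m` times a rational
number whose reduced denominator is coprime to `m`. For `m = p ^ r` with `r ≥ 1` this says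
`a - b ∈ p ^ r ℤ_(p)`. -/
def RatModEq (m : ℕ) (a b : ℚ) : Prop :=
  ∃ c : ℚ, c.den.Coprime m ∧ a - b = (m : ℚ) * c

/-!
Write `n = p - 1` and let `w_k = (-1) ^ k * C(n, k) * C(n + k, n)` be the coefficients of the
shifted Legendre polynomial. Newton's difference formula gives `∑ w_k = (-1) ^ n` and
`∑ w_k * C(n + k, n) = (-1) ^ n * A'_n`, while `A_n = ∑ w_k ^ 2`. For `0 < k < p` the factors of
`w_k` pair up to
`w_k = p / k * (1 - p / k) * ∏_{0 < j < k} (1 - p ^ 2 / j ^ 2)`,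
so modulo `p ^ 4` all three sums become combinations of multiple harmonic sums. The reflection
`k ↦ p - k`, the stuffle product and the relation coming from `∑ w_k = 1` express everything
through `p ^ 3 * H(1, 2)` with `H(1, 2) = ∑_{0 < j < k < p} 1 / (j * k ^ 2)`. Finally
`1 / j = j ^ (p - 2)` modulo `p`, so Faulhaber's formula for the inner sum turns `H(1, 2)` into
a sum of `B_i` times power sums over `(ℤ / p)ˣ`, of which only the one with `i = p - 3` survives.
-/

open Finset
open Polynomial (shiftedLegendre coeff_shiftedLegendre)
open scoped Ring

theorem sq_dvd_prod_one_add_mul_sub {ι R : Type*} [CommRing R] (a : R) (f : ι → R)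
    (s : Finset ι) : a ^ 2 ∣ ∏ i ∈ s, (1 + a * f i) - (1 + a * ∑ i ∈ s, f i) := by
  classical
  induction s using Finset.induction_on with
  | empty => simp
  | insert i s hi ih =>
    obtain ⟨c, hc⟩ := ih
    refine ⟨f i * ∑ j ∈ s, f j + (1 + a * f i) * c, ?_⟩
    rw [prod_insert hi, sum_insert hi]
    linear_combination (1 + a * f i) * hc

section BinomialIdentities

theorem sum_neg_one_pow_mul_choose_mul_choose_add (m r y : ℕ) :
    ∑ k ∈ range (m + 1), (-1 : ℤ) ^ k * m.choose k * (y + k).choose (m + r) =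
      (-1) ^ m * y.choose r := by
  have newton := fwdDiff_iter_eq_sum_shift 1 (fun x : ℕ ↦ (x.choose (m + r) : ℤ)) m y
  rw [fwdDiff_iter_choose] at newton
  simp only [smul_eq_mul, mul_one] at newton
  rw [newton, mul_sum]
  refine sum_congr rfl fun k hk ↦ ?_
  obtain ⟨l, rfl⟩ := Nat.exists_eq_add_of_le (mem_range_succ_iff.mp hk)
  have : ((-1 : ℤ) ^ l) * (-1) ^ l = 1 := by rw [← mul_pow]; simp
  rw [Nat.add_sub_cancel_left, pow_add]
  linear_combination (-(-1 : ℤ) ^ k * (k + l).choose k * (y + k).choose (k + l + r)) * this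

theorem add_choose_right_eq_sum (n k : ℕ) :
    (n + k).choose n = ∑ j ∈ range (n + 1), n.choose j * k.choose j := by
  rw [add_comm, Nat.add_choose_eq, Nat.sum_antidiagonal_eq_sum_range_succ_mk]
  refine sum_congr rfl fun j hj ↦ ?_
  rw [mul_comm, Nat.choose_symm (mem_range_succ_iff.mp hj)]

theorem sum_coeff_shiftedLegendre_mul_choose {n j : ℕ} (hj : j ≤ n) :
    ∑ k ∈ range (n + 1), (shiftedLegendre n).coeff k * k.choose j =
      (-1) ^ n * n.choose j * (n + j).choose j := by
  obtain ⟨m, rfl⟩ := Nat.exists_eq_add_of_le hj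
  have low : ∑ k ∈ range j, (shiftedLegendre (j + m)).coeff k * k.choose j = 0 :=
    sum_eq_zero fun k hk ↦ by rw [Nat.choose_eq_zero_of_lt (mem_range.mp hk)]; simp
  rw [add_assoc, sum_range_add, low, zero_add]
  have term (l : ℕ) : (shiftedLegendre (j + m)).coeff (j + l) * (j + l).choose j =
      (-1) ^ j * (j + m).choose j *
        ((-1) ^ l * m.choose l * (j + m + j + l).choose (m + j)) := by
    have trinomial : ((j + m).choose (j + l) * (j + l).choose j : ℤ) =
        (j + m).choose j * m.choose l := by
      have := Nat.choose_mul (n := j + m) (Nat.le_add_right j l)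
      simp only [Nat.add_sub_cancel_left] at this
      exact_mod_cast this
    rw [coeff_shiftedLegendre, pow_add, add_comm m j, ← add_assoc (j + m)]
    linear_combination (-1 : ℤ) ^ j * (-1) ^ l * (j + m + j + l).choose (j + m) * trinomial
  simp only [term, ← mul_sum, sum_neg_one_pow_mul_choose_mul_choose_add]
  ring

theorem sum_coeff_shiftedLegendre (n : ℕ) :
    ∑ k ∈ range (n + 1), (shiftedLegendre n).coeff k = (-1) ^ n := by
  simpa using sum_coeff_shiftedLegendre_mul_choose n.zero_le

theorem aperyA_eq_sum_sq_coeff_shiftedLegendre (n : ℕ) :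
    (aperyA n : ℤ) = ∑ k ∈ range (n + 1), (shiftedLegendre n).coeff k ^ 2 := by
  have sign (k : ℕ) : ((-1 : ℤ) ^ k) ^ 2 = 1 := by rw [← pow_mul']; simp
  simp only [aperyA, coeff_shiftedLegendre, mul_pow, sign, one_mul, Nat.cast_sum, Nat.cast_mul,
    Nat.cast_pow]
  exact sum_congr rfl fun k _ ↦ by rw [Nat.choose_symm_add]

theorem sum_coeff_shiftedLegendre_mul_add_choose (n : ℕ) :
    ∑ k ∈ range (n + 1), (shiftedLegendre n).coeff k * (n + k).choose n =
      (-1) ^ n * aperyA' n := by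
  simp only [add_choose_right_eq_sum, Nat.cast_sum, Nat.cast_mul, mul_sum, aperyA']
  rw [sum_comm]
  refine sum_congr rfl fun j hj ↦ ?_
  calc ∑ k ∈ range (n + 1), (shiftedLegendre n).coeff k * (n.choose j * k.choose j)
      = n.choose j * ∑ k ∈ range (n + 1), (shiftedLegendre n).coeff k * k.choose j := by
        rw [mul_sum]; exact sum_congr rfl fun k _ ↦ by ring
    _ = (-1) ^ n * (n.choose j ^ 2 * (n + j).choose j : ℕ) := by
        rw [sum_coeff_shiftedLegendre_mul_choose (mem_range_succ_iff.mp hj)]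
        push_cast
        ring

end BinomialIdentities

section HarmonicSums

variable (R : Type*) [CommRing R]

/-- The power sum `∑_{0 < k < n} k⁻ʳ` in `R`; it is meaningful when `1, …, n - 1` are units
of `R`. -/
noncomputable def harmonicSum (r n : ℕ) : R :=
  ∑ k ∈ Ico 1 n, (k : R)⁻¹ʳ ^ r

/-- The multiple harmonic sum `∑_{0 < j < k < n} j⁻ᵃ k⁻ᵇ` in `R`; it is meaningful when
`1, …, n - 1` are units of `R`. -/
noncomputable def harmonicDoubleSum (a b n : ℕ) : R :=
  ∑ k ∈ Ico 1 n, (k : R)⁻¹ʳ ^ b * harmonicSum R a k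

theorem harmonicSum_mul_harmonicSum (a b n : ℕ) :
    harmonicSum R a n * harmonicSum R b n =
      harmonicDoubleSum R a b n + harmonicDoubleSum R b a n + harmonicSum R (a + b) n := by
  simp only [harmonicDoubleSum]
  induction n with
  | zero => simp [harmonicSum]
  | succ n ih =>
    obtain rfl | hn := n.eq_zero_or_pos
    · simp [harmonicSum]
    · simp only [harmonicSum, sum_Ico_succ_top hn] at ih ⊢
      linear_combination ih

variable {R}

theorem map_ringInverse {S : Type*} [CommRing S] (f : R →+* S) {x : R} (hx : IsUnit x) :
    f x⁻¹ʳ = (f x)⁻¹ʳ := by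
  obtain ⟨u, rfl⟩ := hx
  simpa using (Ring.inverse_unit (Units.map (f : R →* S) u)).symm

theorem map_harmonicDoubleSum {S : Type*} [CommRing S] (f : R →+* S) (a b : ℕ) {n : ℕ}
    (hu : ∀ k ∈ Ico 1 n, IsUnit (k : R)) :
    f (harmonicDoubleSum R a b n) = harmonicDoubleSum S a b n := by
  have map_inv {k : ℕ} (hk : k ∈ Ico 1 n) : f (k : R)⁻¹ʳ = (k : S)⁻¹ʳ := by
    rw [map_ringInverse f (hu k hk), map_natCast]
  simp only [harmonicDoubleSum, harmonicSum, map_sum, map_mul, map_pow]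
  refine sum_congr rfl fun k hk ↦ ?_
  rw [map_inv hk]
  congr 1
  exact sum_congr rfl fun j hj ↦ by
    rw [map_inv (Ico_subset_Ico_right (mem_Ico.mp hk).2.le hj)]

section Reflection

theorem two_mul_harmonicSum_eq_sum_reflect (r n : ℕ) :
    2 * harmonicSum R r (n + 1) =
      ∑ k ∈ Ico 1 (n + 1), ((k : R)⁻¹ʳ ^ r + ((n + 1 - k : ℕ) : R)⁻¹ʳ ^ r) := by
  have reflect := sum_Ico_reflect (fun k : ℕ ↦ (k : R)⁻¹ʳ ^ r) 1 (n + 1).le_succ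
  simp only [Nat.add_sub_cancel_left, Nat.add_sub_cancel] at reflect
  rw [sum_add_distrib, reflect, ← harmonicSum, two_mul]

variable {n : ℕ} (hu : ∀ k ∈ Ico 1 (n + 1), IsUnit (k : R))
include hu

theorem inverse_natCast_add_inverse_natCast_reflect {k : ℕ} (hk : k ∈ Ico 1 (n + 1)) :
    (k : R)⁻¹ʳ + ((n + 1 - k : ℕ) : R)⁻¹ʳ =
      (n + 1) * ((k : R)⁻¹ʳ * ((n + 1 - k : ℕ) : R)⁻¹ʳ) := by
  have hk' : n + 1 - k ∈ Ico 1 (n + 1) := by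
    rw [mem_Ico] at hk ⊢
    omega
  have add : (k : R) + (n + 1 - k : ℕ) = n + 1 := by
    rw [← Nat.cast_add, Nat.add_sub_cancel' (mem_Ico.mp hk).2.le, Nat.cast_succ]
  rw [Ring.inverse_add_inverse (iff_of_true (hu k hk) (hu _ hk')), add]
  ring

theorem dvd_two_mul_harmonicSum_of_odd {r : ℕ} (hr : Odd r) :
    (n + 1 : R) ∣ 2 * harmonicSum R r (n + 1) := by
  rw [two_mul_harmonicSum_eq_sum_reflect]
  refine dvd_sum fun k hk ↦ dvd_trans ?_ (hr.add_dvd_pow_add_pow _ _)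
  rw [inverse_natCast_add_inverse_natCast_reflect hu hk]
  exact dvd_mul_right _ _

theorem cube_dvd_two_mul_harmonicSum_one_add :
    (n + 1 : R) ^ 3 ∣ 2 * harmonicSum R 1 (n + 1) + (n + 1) * harmonicSum R 2 (n + 1) +
      (n + 1) ^ 2 * harmonicSum R 3 (n + 1) := by
  rw [two_mul_harmonicSum_eq_sum_reflect, harmonicSum, harmonicSum, mul_sum, mul_sum,
    ← sum_add_distrib, ← sum_add_distrib]
  refine dvd_sum fun k hk ↦ ⟨(k : R)⁻¹ʳ ^ 3 * ((n + 1 - k : ℕ) : R)⁻¹ʳ, ?_⟩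
  linear_combination (1 + (n + 1) * (k : R)⁻¹ʳ + (n + 1) ^ 2 * (k : R)⁻¹ʳ ^ 2) *
    inverse_natCast_add_inverse_natCast_reflect hu hk

end Reflection

section BinomialExpansions

theorem neg_one_pow_mul_choose_eq_prod (n : ℕ) {k : ℕ}
    (hu : ∀ j ∈ Ico 1 (k + 1), IsUnit (j : R)) :
    (-1) ^ k * (n.choose k : R) = ∏ j ∈ Ico 1 (k + 1), (1 - (n + 1) * (j : R)⁻¹ʳ) := by
  induction k with
  | zero => simp
  | succ k ih =>
    have absorb : (n.choose (k + 1) * (k + 1) : R) = n.choose k * (n - k) := by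
      obtain hk | hk := le_or_gt k n
      · exact_mod_cast congrArg (Nat.cast (R := R)) (Nat.choose_succ_right_eq n k)
      · simp [Nat.choose_eq_zero_of_lt hk, Nat.choose_eq_zero_of_lt (hk.trans k.lt_succ_self)]
    have cancel := Ring.mul_inverse_cancel _ (hu (k + 1) (by simp))
    rw [prod_Ico_succ_top (by simp),
      ← ih fun j hj ↦ hu j (Ico_subset_Ico_right (k + 1).le_succ hj)]
    push_cast at cancel ⊢
    linear_combination (-1) ^ (k + 1) * ((k : R) + 1)⁻¹ʳ * absorb
      - (-1) ^ (k + 1) * (n.choose (k + 1) + n.choose k : R) * cancel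

theorem add_choose_succ_eq_mul_prod (n : ℕ) {k : ℕ}
    (hu : ∀ j ∈ Ico 1 (k + 2), IsUnit (j : R)) :
    ((n + (k + 1)).choose (k + 1) : R) =
      (n + 1) * ((k + 1 : ℕ) : R)⁻¹ʳ * ∏ j ∈ Ico 1 (k + 1), (1 + (n + 1) * (j : R)⁻¹ʳ) := by
  induction k with
  | zero => simp
  | succ k ih =>
    have absorb : ((n + (k + 2)).choose (k + 2) * (k + 2) : R) =
        (n + k + 2) * (n + (k + 1)).choose (k + 1) := by
      have := Nat.add_one_mul_choose_eq (n + (k + 1)) (k + 1)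
      exact_mod_cast congrArg (Nat.cast (R := R)) this.symm
    have cancel := Ring.mul_inverse_cancel _ (hu (k + 2) (by simp))
    have cancel' := Ring.mul_inverse_cancel _ (hu (k + 1) (by simp))
    have ih := ih fun j hj ↦ hu j (Ico_subset_Ico_right (k + 2).le_succ hj)
    rw [prod_Ico_succ_top (by simp), show k + 1 + 1 = k + 2 from rfl]
    push_cast at cancel cancel' ih ⊢
    set P := ∏ j ∈ Ico 1 (k + 1), (1 + (n + 1) * (j : R)⁻¹ʳ)
    linear_combination ((k : R) + 2)⁻¹ʳ * absorb - ((n + (k + 2)).choose (k + 2) : R) * cancel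
      + (n + k + 2) * ((k : R) + 2)⁻¹ʳ * ih + P * (n + 1) * ((k : R) + 2)⁻¹ʳ * cancel'

variable {n k : ℕ} (hu : ∀ j ∈ Ico 1 (n + 1), IsUnit (j : R)) (hk : k ∈ Ico 1 (n + 1))
include hu hk

theorem cube_dvd_add_choose_sub :
    (n + 1 : R) ^ 3 ∣ ((n + k).choose n : R) -
      (n + 1) * (k : R)⁻¹ʳ * (1 + (n + 1) * harmonicSum R 1 k) := by
  obtain ⟨k, rfl⟩ := Nat.exists_eq_add_of_le' (mem_Ico.mp hk).1
  have hu' : ∀ j ∈ Ico 1 (k + 2), IsUnit (j : R) :=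
    fun j hj ↦ hu j (Ico_subset_Ico_right (mem_Ico.mp hk).2 hj)
  obtain ⟨c, hc⟩ := sq_dvd_prod_one_add_mul_sub (n + 1 : R) (fun j : ℕ ↦ (j : R)⁻¹ʳ)
    (Ico 1 (k + 1))
  refine ⟨((k + 1 : ℕ) : R)⁻¹ʳ * c, ?_⟩
  rw [Nat.choose_symm_add, add_choose_succ_eq_mul_prod n hu', eq_add_of_sub_eq' hc]
  simp only [harmonicSum, pow_one]
  ring

theorem coeff_shiftedLegendre_eq_mul_prod :
    ((shiftedLegendre n).coeff k : R) = (n + 1) * (k : R)⁻¹ʳ * (1 - (n + 1) * (k : R)⁻¹ʳ) *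
      ∏ j ∈ Ico 1 k, (1 + (n + 1) ^ 2 * -(j : R)⁻¹ʳ ^ 2) := by
  obtain ⟨k, rfl⟩ := Nat.exists_eq_add_of_le' (mem_Ico.mp hk).1
  have hu' : ∀ j ∈ Ico 1 (k + 2), IsUnit (j : R) :=
    fun j hj ↦ hu j (Ico_subset_Ico_right (mem_Ico.mp hk).2 hj)
  have factor (j : ℕ) : (1 + (n + 1) ^ 2 * -(j : R)⁻¹ʳ ^ 2) =
      (1 - (n + 1) * (j : R)⁻¹ʳ) * (1 + (n + 1) * (j : R)⁻¹ʳ) := by ring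
  rw [coeff_shiftedLegendre, Nat.choose_symm_add]
  simp only [Int.cast_mul, Int.cast_pow, Int.cast_neg, Int.cast_one, Int.cast_natCast]
  rw [neg_one_pow_mul_choose_eq_prod n hu', add_choose_succ_eq_mul_prod n hu',
    prod_Ico_succ_top (by simp)]
  simp only [factor, prod_mul_distrib]
  ring

theorem coeff_shiftedLegendre_eq_of_pow_four_eq_zero (hN : (n + 1 : R) ^ 4 = 0) :
    ((shiftedLegendre n).coeff k : R) = (n + 1) * (k : R)⁻¹ʳ - (n + 1) ^ 2 * (k : R)⁻¹ʳ ^ 2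
      - (n + 1) ^ 3 * ((k : R)⁻¹ʳ * harmonicSum R 2 k) := by
  obtain ⟨c, hc⟩ :=
    sq_dvd_prod_one_add_mul_sub ((n + 1 : R) ^ 2) (fun j : ℕ ↦ -(j : R)⁻¹ʳ ^ 2) (Ico 1 k)
  rw [sum_neg_distrib, ← harmonicSum] at hc
  rw [coeff_shiftedLegendre_eq_mul_prod hu hk]
  linear_combination (n + 1) * (k : R)⁻¹ʳ * (1 - (n + 1) * (k : R)⁻¹ʳ) * hc +
    ((n + 1) * (k : R)⁻¹ʳ * (1 - (n + 1) * (k : R)⁻¹ʳ) * c +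
      (k : R)⁻¹ʳ ^ 2 * harmonicSum R 2 k) * hN

end BinomialExpansions

theorem sum_range_succ_coeff_shiftedLegendre_mul (n : ℕ) (f : ℕ → R) :
    ∑ k ∈ range (n + 1), ((shiftedLegendre n).coeff k : R) * f k =
      f 0 + ∑ k ∈ Ico 1 (n + 1), ((shiftedLegendre n).coeff k : R) * f k := by
  rw [range_eq_Ico, sum_eq_sum_Ico_succ_bot n.succ_pos]
  simp [coeff_shiftedLegendre]

section NilpotentModulus

theorem isUnit_two_of_even {n : ℕ} (hn : Even n) (hN : IsNilpotent (n + 1 : R)) :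
    IsUnit (2 : R) := by
  obtain ⟨m, rfl⟩ := hn
  refine isUnit_of_mul_isUnit_left (y := -(m : R)) ?_
  convert hN.isUnit_one_sub using 1
  push_cast
  ring

variable {n : ℕ} (hu : ∀ j ∈ Ico 1 (n + 1), IsUnit (j : R)) (hN : (n + 1 : R) ^ 4 = 0)
include hu hN

theorem neg_one_pow_eq_of_pow_four_eq_zero :
    (-1 : R) ^ n = 1 + (n + 1) * harmonicSum R 1 (n + 1) - (n + 1) ^ 2 * harmonicSum R 2 (n + 1)
      - (n + 1) ^ 3 * harmonicDoubleSum R 2 1 (n + 1) := by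
  have total := congrArg (Int.cast (R := R)) (sum_coeff_shiftedLegendre n)
  have expand := sum_range_succ_coeff_shiftedLegendre_mul n (fun _ ↦ (1 : R))
  simp only [mul_one] at expand
  push_cast at total
  rw [← total, expand, sum_congr rfl fun k hk ↦
    coeff_shiftedLegendre_eq_of_pow_four_eq_zero hu hk hN]
  simp only [harmonicSum, harmonicDoubleSum, sum_sub_distrib, ← mul_sum, pow_one]
  ring

theorem aperyA_eq_of_pow_four_eq_zero :
    (aperyA n : R) = 1 + (n + 1) ^ 2 * harmonicSum R 2 (n + 1)
      - 2 * (n + 1) ^ 3 * harmonicSum R 3 (n + 1) := by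
  have total := congrArg (Int.cast (R := R)) (aperyA_eq_sum_sq_coeff_shiftedLegendre n)
  have expand := sum_range_succ_coeff_shiftedLegendre_mul n
    (fun k ↦ ((shiftedLegendre n).coeff k : R))
  have term {k : ℕ} (hk : k ∈ Ico 1 (n + 1)) :
      ((shiftedLegendre n).coeff k : R) * (shiftedLegendre n).coeff k =
        (n + 1) ^ 2 * (k : R)⁻¹ʳ ^ 2 - 2 * (n + 1) ^ 3 * (k : R)⁻¹ʳ ^ 3 := by
    rw [coeff_shiftedLegendre_eq_of_pow_four_eq_zero hu hk hN]
    set y := (k : R)⁻¹ʳ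
    set h := harmonicSum R 2 k
    linear_combination ((y ^ 2 + (n + 1) * (y * h)) ^ 2 - 2 * y * (y * h)) * hN
  push_cast at total
  simp only [sq] at total
  rw [total, expand, sum_congr rfl fun k hk ↦ term hk]
  simp only [harmonicSum, sum_sub_distrib, ← mul_sum, coeff_shiftedLegendre, pow_zero,
    Nat.choose_zero_right, add_zero, Nat.choose_self, Nat.cast_one, mul_one, Int.cast_one]
  ring

theorem neg_one_pow_mul_aperyA'_eq_of_pow_four_eq_zero :
    (-1) ^ n * (aperyA' n : R) = 1 + (n + 1) ^ 2 * harmonicSum R 2 (n + 1)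
      + (n + 1) ^ 3 * (harmonicDoubleSum R 1 2 (n + 1) - harmonicSum R 3 (n + 1)) := by
  have total := congrArg (Int.cast (R := R)) (sum_coeff_shiftedLegendre_mul_add_choose n)
  have expand := sum_range_succ_coeff_shiftedLegendre_mul n (fun k ↦ ((n + k).choose n : R))
  have term {k : ℕ} (hk : k ∈ Ico 1 (n + 1)) :
      ((shiftedLegendre n).coeff k : R) * (n + k).choose n = (n + 1) ^ 2 * (k : R)⁻¹ʳ ^ 2
        + (n + 1) ^ 3 * ((k : R)⁻¹ʳ ^ 2 * harmonicSum R 1 k - (k : R)⁻¹ʳ ^ 3) := by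
    obtain ⟨c, hc⟩ := cube_dvd_add_choose_sub hu hk
    rw [coeff_shiftedLegendre_eq_of_pow_four_eq_zero hu hk hN, eq_add_of_sub_eq' hc]
    set y := (k : R)⁻¹ʳ
    set h := harmonicSum R 2 k
    set g := harmonicSum R 1 k
    linear_combination (y * c - y ^ 3 * g - (n + 1) * y ^ 2 * c
      - y * h * (y * (1 + (n + 1) * g) + (n + 1) ^ 2 * c)) * hN
  push_cast at total
  rw [← total, expand, sum_congr rfl fun k hk ↦ term hk]
  simp only [harmonicSum, harmonicDoubleSum, sum_add_distrib, sum_sub_distrib, ← mul_sum,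
    pow_one, add_zero, Nat.choose_self, Nat.cast_one]
  ring

variable (hn : Even n)
include hn

theorem cube_mul_harmonicSum_eq_zero_of_odd {r : ℕ} (hr : Odd r) :
    (n + 1 : R) ^ 3 * harmonicSum R r (n + 1) = 0 := by
  obtain ⟨c, hc⟩ := dvd_two_mul_harmonicSum_of_odd hu hr
  refine (isUnit_two_of_even hn ⟨4, hN⟩).mul_left_cancel ?_
  linear_combination (n + 1) ^ 3 * hc + c * hN

theorem three_mul_sq_mul_harmonicSum_two :
    3 * (n + 1) ^ 2 * harmonicSum R 2 (n + 1) =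
      2 * (n + 1) ^ 3 * harmonicDoubleSum R 1 2 (n + 1) := by
  have relation := neg_one_pow_eq_of_pow_four_eq_zero hu hN
  rw [hn.neg_one_pow] at relation
  obtain ⟨c, reflection⟩ := cube_dvd_two_mul_harmonicSum_one_add hu
  have odd_one_vanish := cube_mul_harmonicSum_eq_zero_of_odd hu hN hn odd_one
  have odd_three_vanish := cube_mul_harmonicSum_eq_zero_of_odd hu hN hn (r := 3) (by decide)
  have stuffle := harmonicSum_mul_harmonicSum R 1 2 (n + 1)
  linear_combination (n + 1) * reflection + 2 * relation
    + 2 * (n + 1) ^ 3 * stuffle - 2 * harmonicSum R 2 (n + 1) * odd_one_vanish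
    + odd_three_vanish + c * hN

theorem three_mul_aperyA_eq :
    3 * (aperyA n : R) = 3 + 2 * (n + 1) ^ 3 * harmonicDoubleSum R 1 2 (n + 1) := by
  have vanish := cube_mul_harmonicSum_eq_zero_of_odd hu hN hn (r := 3) (by decide)
  linear_combination 3 * aperyA_eq_of_pow_four_eq_zero hu hN +
    three_mul_sq_mul_harmonicSum_two hu hN hn - 6 * vanish

theorem three_mul_aperyA'_eq :
    3 * (aperyA' n : R) = 3 + 5 * (n + 1) ^ 3 * harmonicDoubleSum R 1 2 (n + 1) := by
  have expansion := neg_one_pow_mul_aperyA'_eq_of_pow_four_eq_zero hu hN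
  rw [hn.neg_one_pow, one_mul] at expansion
  have vanish := cube_mul_harmonicSum_eq_zero_of_odd hu hN hn (r := 3) (by decide)
  linear_combination 3 * expansion +
    three_mul_sq_mul_harmonicSum_two hu hN hn - 3 * vanish

end NilpotentModulus

end HarmonicSums

section BernoulliModPrime

variable {p : ℕ} [Fact p.Prime]

theorem norm_bernoulli_le_one {r : ℕ} (hr : r + 1 < p) : ‖(bernoulli r : ℚ_[p])‖ ≤ 1 := by
  induction r using Nat.strong_induction_on with
  | _ r ih =>
    have unit : ‖((r + 1 : ℕ) : ℚ_[p])‖ = 1 :=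
      Padic.norm_natCast_eq_one_iff.mpr
        (Nat.coprime_of_lt_prime r.succ_ne_zero hr Fact.out)
    have recursion := congrArg (Rat.cast (K := ℚ_[p])) (sum_bernoulli (r + 1))
    rw [sum_range_succ, Nat.choose_succ_self_right] at recursion
    push_cast at recursion
    have integral : (r + 1 : ℚ_[p]) * bernoulli r ∈ PadicInt.subring p := by
      rw [eq_sub_of_add_eq' recursion]
      refine sub_mem (by split_ifs <;> simp [one_mem, zero_mem]) (sum_mem fun k hk ↦ mul_mem ?_ ?_)
      · exact natCast_mem _ _
      · exact ih k (mem_range.mp hk) (by grind)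
    rwa [PadicInt.mem_subring_iff, norm_mul, ← Nat.cast_succ, unit, one_mul] at integral

variable (p) in
/-- The Bernoulli number `B_r` as a `p`-adic integer; it takes the junk value `0` when `B_r` is
not `p`-integral, which does not happen for `r < p - 1`. -/
noncomputable def padicBernoulli (r : ℕ) : ℤ_[p] :=
  if h : ‖(bernoulli r : ℚ_[p])‖ ≤ 1 then ⟨bernoulli r, h⟩ else 0

theorem coe_padicBernoulli {r : ℕ} (hr : r + 1 < p) :
    (padicBernoulli p r : ℚ_[p]) = bernoulli r :=
  congrArg Subtype.val (dif_pos (norm_bernoulli_le_one hr))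

theorem succ_mul_sum_range_pow_eq_sum_padicBernoulli {m : ℕ} (hm : m + 1 < p) (k : ℕ) :
    (m + 1) * ∑ j ∈ range k, (j : ℤ_[p]) ^ m =
      ∑ i ∈ range (m + 1), padicBernoulli p i * (m + 1).choose i * k ^ (m + 1 - i) := by
  have faulhaber : (m + 1) * ∑ j ∈ range k, (j : ℚ) ^ m =
      ∑ i ∈ range (m + 1), bernoulli i * (m + 1).choose i * (k : ℚ) ^ (m + 1 - i) := by
    rw [sum_range_pow, ← sum_div, mul_div_cancel₀ _ (by positivity)]
  apply Subtype.coe_injective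
  calc (((m + 1) * ∑ j ∈ range k, (j : ℤ_[p]) ^ m : ℤ_[p]) : ℚ_[p])
      = ((m + 1) * ∑ j ∈ range k, (j : ℚ) ^ m : ℚ) := by
        push_cast [PadicInt.coe_sum]; rfl
    _ = ∑ i ∈ range (m + 1), (bernoulli i : ℚ_[p]) * (m + 1).choose i * k ^ (m + 1 - i) := by
        rw [faulhaber]; push_cast; rfl
    _ = _ := by
        push_cast [PadicInt.coe_sum]
        exact sum_congr rfl fun i hi ↦ by rw [coe_padicBernoulli (by grind)]

theorem natCast_zmod_ne_zero {k : ℕ} (hk : k ∈ Ico 1 p) : (k : ZMod p) ≠ 0 := by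
  rw [Ne, ZMod.natCast_eq_zero_iff]
  exact Nat.not_dvd_of_pos_of_lt (mem_Ico.mp hk).1 (mem_Ico.mp hk).2

theorem harmonicSum_zmod (r : ℕ) :
    harmonicSum (ZMod p) r p = if p - 1 ∣ r then -1 else 0 := by
  have sum_units := FiniteField.sum_pow_units (ZMod p) r
  rw [ZMod.card] at sum_units
  rw [← sum_units, harmonicSum]
  symm
  refine sum_nbij (fun u : (ZMod p)ˣ ↦ (↑u⁻¹ : ZMod p).val) (fun u _ ↦ ?_)
    (fun u _ v _ huv ↦ ?_) (fun k hk ↦ ?_) (fun u _ ↦ ?_)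
  · rw [mem_Ico]
    exact ⟨ZMod.val_pos.mpr u⁻¹.ne_zero, ZMod.val_lt _⟩
  · exact inv_injective (Units.ext (ZMod.val_injective p huv))
  · refine ⟨(Units.mk0 (k : ZMod p) (natCast_zmod_ne_zero hk))⁻¹, by simp, ?_⟩
    simp only [inv_inv, Units.val_mk0]
    exact ZMod.val_natCast_of_lt (mem_Ico.mp hk).2
  · rw [ZMod.natCast_zmod_val, Ring.inverse_unit, inv_inv]

theorem choose_prime_sub_one_zmod {i : ℕ} (hi : i < p) :
    ((p - 1).choose i : ZMod p) = (-1) ^ i := by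
  have expand := neg_one_pow_mul_choose_eq_prod (R := ZMod p) (p - 1) (k := i) fun j hj ↦
    (natCast_zmod_ne_zero (Ico_subset_Ico_right hi hj)).isUnit
  rw [Nat.cast_pred hi.pos, CharP.cast_eq_zero (ZMod p) p] at expand
  simp only [zero_sub, neg_add_cancel, zero_mul, sub_zero, prod_const_one] at expand
  have sign : ((-1 : ZMod p) ^ i) * (-1) ^ i = 1 := by rw [← mul_pow]; simp
  linear_combination (-1) ^ i * expand - ((p - 1).choose i : ZMod p) * sign

theorem harmonicSum_one_zmod_eq_sum_padicBernoulli (hp : p ≠ 2) {k : ℕ} (hk : k ∈ Ico 1 p) :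
    harmonicSum (ZMod p) 1 k = -∑ i ∈ range (p - 1),
      (-1) ^ i * PadicInt.toZMod (padicBernoulli p i) * (k : ZMod p)⁻¹ʳ ^ i := by
  obtain ⟨m, rfl⟩ := Nat.exists_eq_add_of_le' (Fact.out : p.Prime).two_le
  have fermat {j : ℕ} (hj : j ∈ Ico 1 (m + 2)) {i : ℕ} (hi : i ≤ m + 1) :
      (j : ZMod (m + 2)) ^ (m + 1 - i) = (j : ZMod (m + 2))⁻¹ʳ ^ i := by
    have := ZMod.pow_card_sub_one_eq_one (natCast_zmod_ne_zero hj)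
    rw [Nat.add_succ_sub_one] at this
    rw [Ring.inverse_eq_inv, pow_sub₀ _ (natCast_zmod_ne_zero hj) hi, this, one_mul, inv_pow]
  have minus_one : (m + 1 : ZMod (m + 2)) = -1 := by
    have := CharP.cast_eq_zero (ZMod (m + 2)) (m + 2)
    push_cast at this
    linear_combination this
  have faulhaber := congrArg PadicInt.toZMod
    (succ_mul_sum_range_pow_eq_sum_padicBernoulli (m + 1).lt_succ_self k)
  simp only [map_mul, map_sum, map_pow, map_add, map_natCast, map_one, minus_one] at faulhaber
  calc harmonicSum (ZMod (m + 2)) 1 k = ∑ j ∈ range k, (j : ZMod (m + 2)) ^ m := by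
        rw [sum_range_eq_add_Ico _ (mem_Ico.mp hk).1, Nat.cast_zero, zero_pow (by omega), zero_add]
        refine sum_congr rfl fun j hj ↦ ?_
        rw [← fermat (Ico_subset_Ico_right (mem_Ico.mp hk).2.le hj) (by omega),
          Nat.add_sub_cancel]
    _ = - ∑ i ∈ range (m + 1), PadicInt.toZMod (padicBernoulli (m + 2) i) * (m + 1).choose i *
        (k : ZMod (m + 2)) ^ (m + 1 - i) := by
        linear_combination -faulhaber
    _ = _ := by
        refine congrArg _ (sum_congr rfl fun i hi ↦ ?_)
        have := choose_prime_sub_one_zmod (p := m + 2) (i := i) (by grind)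
        rw [Nat.add_succ_sub_one] at this
        rw [fermat hk (by grind), this]
        ring

theorem harmonicDoubleSum_one_zmod (hp : p ≠ 2) {i s : ℕ} (his : i + s = p - 1) (hs : 0 < s) :
    harmonicDoubleSum (ZMod p) 1 s p = (-1) ^ i * PadicInt.toZMod (padicBernoulli p i) := by
  have expand : harmonicDoubleSum (ZMod p) 1 s p = -∑ j ∈ range (p - 1),
      (-1) ^ j * PadicInt.toZMod (padicBernoulli p j) * harmonicSum (ZMod p) (j + s) p := by
    simp only [harmonicDoubleSum, harmonicSum.eq_1 _ (_ + s), mul_sum]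
    rw [sum_comm, ← sum_neg_distrib]
    refine sum_congr rfl fun k hk ↦ ?_
    rw [harmonicSum_one_zmod_eq_sum_padicBernoulli hp hk, mul_neg, mul_sum]
    exact congrArg _ (sum_congr rfl fun j _ ↦ by ring)
  rw [expand, sum_eq_single_of_mem i (by grind)]
  · rw [harmonicSum_zmod, if_pos (by rw [his])]
    ring
  · intro j hj hji
    rw [harmonicSum_zmod, if_neg, mul_zero]
    intro hdvd
    have modEq : j + s ≡ i + s [MOD p - 1] := by
      rw [his]
      exact (Nat.modEq_zero_iff_dvd.mpr hdvd).trans (Nat.modEq_zero_iff_dvd.mpr dvd_rfl).symm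
    exact hji ((Nat.ModEq.add_right_cancel' s modEq).eq_of_lt_of_lt (mem_range.mp hj) (by omega))

end BernoulliModPrime

section Transfer

variable {p : ℕ} [Fact p.Prime]

theorem isUnit_natCast_padicInt {k : ℕ} (hk : k ∈ Ico 1 p) : IsUnit (k : ℤ_[p]) := by
  rw [PadicInt.isUnit_iff, PadicInt.norm_natCast_eq_one_iff]
  obtain ⟨k_pos, k_lt⟩ := mem_Ico.mp hk
  exact Nat.coprime_of_lt_prime (Nat.one_le_iff_ne_zero.mp k_pos) k_lt Fact.out

theorem dvd_harmonicDoubleSum_sub_padicBernoulli (hp : p ≠ 2) {i s : ℕ} (his : i + s = p - 1)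
    (hs : 0 < s) :
    (p : ℤ_[p]) ∣ harmonicDoubleSum ℤ_[p] 1 s p - (-1) ^ i * padicBernoulli p i := by
  rw [← Ideal.mem_span_singleton, ← PadicInt.maximalIdeal_eq_span_p, ← PadicInt.ker_toZMod,
    RingHom.mem_ker, map_sub,
    map_harmonicDoubleSum _ _ _ fun _ ↦ isUnit_natCast_padicInt,
    harmonicDoubleSum_one_zmod hp his hs]
  simp

theorem RatModEq.of_mul_sub_eq_mul {r u : ℕ} (hu : u.Coprime p) {a b : ℚ} {c : ℤ_[p]}
    (h : (u * (a - b) : ℚ_[p]) = (p : ℚ_[p]) ^ r * c) : RatModEq (p ^ r) a b := by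
  have hp0 : (p : ℚ_[p]) ≠ 0 := by exact_mod_cast (Fact.out : p.Prime).ne_zero
  have hp0' : (p : ℚ) ≠ 0 := by exact_mod_cast (Fact.out : p.Prime).ne_zero
  have u_unit : ‖(u : ℚ_[p])‖ = 1 := Padic.norm_natCast_eq_one_iff.mpr hu.symm
  have integral : ‖(((a - b) / p ^ r : ℚ) : ℚ_[p])‖ ≤ 1 := by
    have : (u : ℚ_[p]) * ((a - b) / p ^ r : ℚ) = c := by
      push_cast
      rw [← mul_div_assoc, h, mul_div_cancel_left₀ _ (pow_ne_zero r hp0)]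
    calc ‖(((a - b) / p ^ r : ℚ) : ℚ_[p])‖
        = ‖(u : ℚ_[p]) * ((a - b) / p ^ r : ℚ)‖ := by rw [norm_mul, u_unit, one_mul]
      _ = ‖c‖ := by rw [this, PadicInt.norm_def]
      _ ≤ 1 := c.norm_le_one
  refine ⟨(a - b) / p ^ r, Nat.Coprime.pow_right r ?_, ?_⟩
  · have := (Padic.norm_rat_le_one_iff_padicValuation_le_one p).mp integral
    rw [Rat.padicValuation_le_one_iff, ← (Fact.out : p.Prime).coprime_iff_not_dvd] at this
    exact this.symm
  · rw [Nat.cast_pow, mul_div_cancel₀ _ (pow_ne_zero r hp0')]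

theorem ratModEq_of_three_mul_eq (hp5 : 5 ≤ p) {m c : ℕ}
    (h : 3 * (m : ZMod (p ^ 4)) =
      3 + (c : ZMod (p ^ 4)) * (p : ZMod (p ^ 4)) ^ 3 * harmonicDoubleSum (ZMod (p ^ 4)) 1 2 p) :
    RatModEq (p ^ 4) m (1 + (c / 3 : ℚ) * (p : ℚ) ^ 3 * bernoulli (p - 3)) := by
  obtain ⟨d, hd⟩ : (p : ℤ_[p]) ^ 4 ∣ 3 * m - (3 + c * p ^ 3 * harmonicDoubleSum ℤ_[p] 1 2 p) := by
    rw [← Ideal.mem_span_singleton, ← PadicInt.ker_toZModPow, RingHom.mem_ker]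
    simp [map_harmonicDoubleSum (PadicInt.toZModPow 4) 1 2 fun _ ↦ isUnit_natCast_padicInt,
      map_ofNat, h]
  obtain ⟨e, he⟩ := dvd_harmonicDoubleSum_sub_padicBernoulli (p := p) (i := p - 3) (s := 2)
    (by omega) (by omega) two_pos
  have sign : Even (p - 3) := by
    have := (Fact.out : p.Prime).even_sub_one (by omega)
    grind
  rw [sign.neg_one_pow, one_mul] at he
  have congruence : (3 * m - 3 - c * p ^ 3 * padicBernoulli p (p - 3) : ℤ_[p]) =
      p ^ 4 * (d + c * e) := by
    linear_combination hd + c * p ^ 3 * he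
  refine RatModEq.of_mul_sub_eq_mul (u := 3) (c := d + c * e) ?_ ?_
  · exact (Nat.coprime_of_lt_prime three_ne_zero (by omega) Fact.out).symm
  · have := congrArg ((↑) : ℤ_[p] → ℚ_[p]) congruence
    have coe_three : ((3 : ℤ_[p]) : ℚ_[p]) = 3 := rfl
    push_cast [coe_three, coe_padicBernoulli (p := p) (r := p - 3) (by omega)] at this ⊢
    linear_combination this

end Transfer

theorem mainTheorem3 (p : ℕ) (hp : p.Prime) (hp5 : 5 ≤ p) :
    RatModEq (p ^ 4) (aperyA (p - 1) : ℚ) (1 + (2 / 3 : ℚ) * (p : ℚ) ^ 3 * bernoulli (p - 3)) ∧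
    RatModEq (p ^ 4) (aperyA' (p - 1) : ℚ)
      (1 + (5 / 3 : ℚ) * (p : ℚ) ^ 3 * bernoulli (p - 3)) := by
  have : Fact p.Prime := ⟨hp⟩
  obtain ⟨n, rfl⟩ := Nat.exists_eq_add_of_le' hp.one_le
  have n_even : Even n := hp.even_sub_one (by omega)
  have isUnit_cast : ∀ k ∈ Ico 1 (n + 1), IsUnit (k : ZMod ((n + 1) ^ 4)) := fun k hk ↦ by
    simpa using (isUnit_natCast_padicInt hk).map (PadicInt.toZModPow 4)
  have pow_four_eq_zero : (n + 1 : ZMod ((n + 1) ^ 4)) ^ 4 = 0 := by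
    exact_mod_cast ZMod.natCast_self ((n + 1) ^ 4)
  constructor
  · apply ratModEq_of_three_mul_eq hp5 (c := 2)
    exact_mod_cast three_mul_aperyA_eq isUnit_cast pow_four_eq_zero n_even
  · apply ratModEq_of_three_mul_eq hp5 (c := 5)
    exact_mod_cast three_mul_aperyA'_eq isUnit_cast pow_four_eq_zero n_even
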